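/- For each natural number $n$, let $B_n$ be the algebra on the set $\{0,1,\dots,2^n-1\}$ whose binary operation $\backslash$ is defined by the recursion $$0\backslash x = x,\qquad x\backslash(2^n-1)=x-1\ \ (x>0),\qquad x\backslash(y-1)=(x\backslash y)\backslash(x-1)\ \ (x,y>0).$$ (For $x\neq 0$ one has $x\backslash y<x$, so the recursion is valid.) Each $B_n$ is a subalgebra of $B_{n+1}$; let $B_\infty=\bigcup_n B_n$, an algebra on the set of all nonnegative integers, with operation $\backslash$. For $x>0$, the sequence $x\backslash 0,\ x\backslash 1,\ x\backslash 2,\dots$ in $B_\infty$ is periodic, and its least positive period is called the period length of $x$ in $B_\infty$. **Lemma 4.3.** Let $s\le s'$ be nonnegative integers such that $s'-s\le 2^k$ for some $k\ge 0$ with $2^k\mid 2s$. Then $2^{s'}-2^s+1$ has period length $2^{s'-s}$ in $B_\infty$. This is the largest possible value: $2^{s'}-2^s$ has exactly $s'-s$ bits equal to $1$ in its binary representation, and for every nonnegative integer $x$ with exactly $s'-s$ bits equal to $1$ in its binary representation, the period length of $x+1$ in $B_\infty$ is at most $2^{s'-s}$. -/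

import Mathlib

namespace Laver

/-- Auxiliary recursion for the operation of the backward Laver table `B_n`, carrying along the
inequality `x ∖ y < x` (for `x ≠ 0`) which makes the recursion well founded. -/
def backAux (n x y : ℕ) : {z : ℕ // if x = 0 then z = y else z < x} :=
  if hx : x = 0 then ⟨y, by simp [hx]⟩
  else if hy : 2 ^ n - 1 ≤ y then ⟨x - 1, by simp only [hx, if_false]; omega⟩
  else
    match backAux n x (y + 1) with
    | ⟨z, hz⟩ =>
      have hzx : z < x := by simpa [hx] using hz
      match backAux n z (x - 1) with
      | ⟨w, hw⟩ => ⟨w, by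
          rw [if_neg hx]
          split_ifs at hw
          · omega
          · omega⟩
termination_by (x, 2 ^ n - 1 - y)

/-- The operation `x ∖ y` of the finite left-distributive algebra `B_n`, whose underlying set is
`{0, 1, …, 2 ^ n - 1}`. Only the values at `x, y < 2 ^ n` matter; there the operation is
determined by `back_zero`, `back_last` and `back_step` below. -/
def back (n x y : ℕ) : ℕ := (backAux n x y).1

/-- `0 ∖ y = y`. -/
theorem back_zero (n y : ℕ) : back n 0 y = y := by
  have := (backAux n 0 y).2
  simpa [back] using this

/-- `x ∖ y < x` for `x > 0`. -/
theorem back_lt (n : ℕ) {x : ℕ} (hx : 0 < x) (y : ℕ) : back n x y < x := by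
  have := (backAux n x y).2
  simpa [back, hx.ne'] using this

theorem back_last' (n : ℕ) {x y : ℕ} (hx : 0 < x) (hy : 2 ^ n - 1 ≤ y) :
    back n x y = x - 1 := by
  unfold back
  rw [backAux, dif_neg hx.ne', dif_pos hy]

/-- `x ∖ (2 ^ n - 1) = x - 1` for `x > 0`. -/
theorem back_last (n : ℕ) {x : ℕ} (hx : 0 < x) : back n x (2 ^ n - 1) = x - 1 :=
  back_last' n hx le_rfl

/-- `x ∖ (y - 1) = (x ∖ y) ∖ (x - 1)` for `x, y > 0`. -/
theorem back_step (n : ℕ) {x y : ℕ} (hx : 0 < x) (hy : 0 < y) (hyn : y < 2 ^ n) :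
    back n x (y - 1) = back n (back n x y) (x - 1) := by
  obtain ⟨y, rfl⟩ : ∃ z, y = z + 1 := ⟨y - 1, by omega⟩
  have h : ¬ (2 ^ n - 1 ≤ y) := by omega
  unfold back
  rw [Nat.add_sub_cancel, backAux, dif_neg hx.ne', dif_neg h]

/-- `B_n` is closed under its operation. -/
theorem back_closed (n : ℕ) {x y : ℕ} (hx : x < 2 ^ n) (hy : y < 2 ^ n) :
    back n x y < 2 ^ n := by
  rcases Nat.eq_zero_or_pos x with rfl | h
  · rwa [back_zero]
  · exact (back_lt n h y).trans hx

/-- Reduction modulo `2 ^ n` is a homomorphism from `B_(n+1)` to `B_n`, provided that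
`x ∖ 0 = 0` holds in `B_n`. -/
theorem back_mod_of (n : ℕ) (P : ∀ x < 2 ^ n, back n x 0 = 0) (x : ℕ) :
    x < 2 ^ (n + 1) → ∀ k y, y + k + 1 = 2 ^ (n + 1) →
      back (n + 1) x y % 2 ^ n = back n (x % 2 ^ n) (y % 2 ^ n) := by
  induction x using Nat.strong_induction_on with
  | _ x ih =>
  intro hx
  have hN : 0 < 2 ^ n := by positivity
  have hNN : 2 ^ (n + 1) = 2 ^ n + 2 ^ n := by ring
  have red : ∀ z, z < 2 ^ (n + 1) → (z < 2 ^ n ∧ z % 2 ^ n = z) ∨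
      (2 ^ n ≤ z ∧ z % 2 ^ n = z - 2 ^ n) := by
    intro z hz
    rcases lt_or_ge z (2 ^ n) with h | h
    · exact Or.inl ⟨h, Nat.mod_eq_of_lt h⟩
    · refine Or.inr ⟨h, ?_⟩
      rw [Nat.mod_eq_sub_mod h, Nat.mod_eq_of_lt (by omega)]
  rcases Nat.eq_zero_or_pos x with rfl | h0
  · intro k y _
    simp [back_zero]
  intro k
  induction k with
  | zero =>
    intro y hy
    obtain rfl : y = 2 ^ (n + 1) - 1 := by omega
    rw [back_last _ h0]
    have e : (2 ^ (n + 1) - 1) % 2 ^ n = 2 ^ n - 1 := by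
      rcases red (2 ^ (n + 1) - 1) (by omega) with h | h <;> omega
    rw [e]
    rcases Nat.eq_zero_or_pos (x % 2 ^ n) with h | h
    · rw [h, back_zero]
      rcases red x hx with h1 | h1 <;> rcases red (x - 1) (by omega) with h2 | h2 <;> omega
    · rw [back_last _ h]
      rcases red x hx with h1 | h1 <;> rcases red (x - 1) (by omega) with h2 | h2 <;> omega
  | succ k ihk =>
    intro y hy
    have s := back_step (n + 1) (x := x) (y := y + 1) h0 (by omega) (by omega)
    rw [Nat.add_sub_cancel] at s
    have hlt := back_lt (n + 1) h0 (y + 1)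
    rw [s, ih _ hlt (by omega) (2 ^ (n + 1) - 1 - (x - 1)) (x - 1) (by omega),
      ihk (y + 1) (by omega)]
    have hy1 := red y (by omega)
    have hy2 := red (y + 1) (by omega)
    have hx1 := red x hx
    have hx2 := red (x - 1) (by omega)
    have hmx : x % 2 ^ n < 2 ^ n := Nat.mod_lt _ hN
    rcases Nat.eq_zero_or_pos (x % 2 ^ n) with h | h
    · have e : (x - 1) % 2 ^ n = 2 ^ n - 1 := by omega
      rw [h, back_zero, back_zero, e]
      rcases Nat.eq_zero_or_pos ((y + 1) % 2 ^ n) with g | g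
      · rw [g, back_zero]; omega
      · rw [back_last _ g]; omega
    · have e : (x - 1) % 2 ^ n = x % 2 ^ n - 1 := by omega
      rw [e]
      rcases Nat.eq_zero_or_pos ((y + 1) % 2 ^ n) with g | g
      · have e2 : y % 2 ^ n = 2 ^ n - 1 := by omega
        rw [g, P _ hmx, back_zero, e2, back_last _ h]
      · have e2 : y % 2 ^ n = (y + 1) % 2 ^ n - 1 := by omega
        rw [e2, back_step n h g (Nat.mod_lt _ hN)]

/-- `x ∖ 0 = 0` in `B_n`. -/
theorem back_right_zero (n : ℕ) : ∀ x < 2 ^ n, back n x 0 = 0 := by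
  induction n with
  | zero =>
    intro x hx
    obtain rfl : x = 0 := by simpa using hx
    rw [back_zero]
  | succ n P =>
    intro x hx
    rcases Nat.eq_zero_or_pos x with rfl | h0
    · rw [back_zero]
    have hN : 0 < 2 ^ n := by positivity
    have hNN : 2 ^ (n + 1) = 2 ^ n + 2 ^ n := by ring
    let F : ℕ → ℕ := fun z => back (n + 1) z (x - 1)
    have hF0 : F 0 = x - 1 := back_zero _ _
    have it : ∀ k y, y + k + 1 = 2 ^ (n + 1) → back (n + 1) x y = F^[k + 1] 0 := by
      intro k
      induction k with
      | zero =>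
        intro y hy
        obtain rfl : y = 2 ^ (n + 1) - 1 := by omega
        rw [back_last _ h0]
        exact hF0.symm
      | succ k ihk =>
        intro y hy
        have s := back_step (n + 1) (x := x) (y := y + 1) h0 (by omega) (by omega)
        rw [Nat.add_sub_cancel] at s
        rw [s, ihk (y + 1) (by omega), Function.iterate_succ_apply' F (k + 1)]
    have v0 := it (2 ^ (n + 1) - 1) 0 (by omega)
    have v1 := it (2 ^ n - 1) (2 ^ n) (by omega)
    rw [Nat.sub_add_cancel (by omega)] at v0 v1
    have m0 := back_mod_of n P x hx (2 ^ (n + 1) - 1) 0 (by omega)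
    have m1 := back_mod_of n P x hx (2 ^ n - 1) (2 ^ n) (by omega)
    have hmx : x % 2 ^ n < 2 ^ n := Nat.mod_lt _ hN
    rw [Nat.zero_mod, P _ hmx] at m0
    rw [Nat.mod_self, P _ hmx] at m1
    have l0 := (back_lt (n + 1) h0 0).trans hx
    have l1 := (back_lt (n + 1) h0 (2 ^ n)).trans hx
    have split : ∀ z, z < 2 ^ (n + 1) → z % 2 ^ n = 0 → z = 0 ∨ z = 2 ^ n := by
      intro z hz hm
      obtain ⟨c, rfl⟩ := Nat.dvd_of_mod_eq_zero hm
      have : c < 2 := by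
        by_contra hc
        have : 2 ^ n * 2 ≤ 2 ^ n * c := Nat.mul_le_mul_left _ (by omega)
        omega
      interval_cases c <;> simp
    have per : ∃ j, 0 < j ∧ F^[j] 0 = 0 := by
      by_contra hcon
      push Not at hcon
      have dec : ∀ k, F^[k + 1] 0 + k < x := by
        intro k
        induction k with
        | zero =>
          change F 0 + 0 < x
          omega
        | succ k ihk =>
          rw [Function.iterate_succ_apply' F (k + 1)]
          have := back_lt (n + 1) (Nat.pos_of_ne_zero (hcon (k + 1) (by omega))) (x - 1)
          change F (F^[k + 1] 0) < _ at this
          omega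
      have := dec x
      omega
    obtain ⟨j, hj, hj0⟩ := per
    have p0 : Function.IsPeriodicPt F j 0 := hj0
    have hsplit : F^[2 ^ (n + 1)] 0 = F^[2 ^ n] (F^[2 ^ n] 0) := by
      rw [hNN, Function.iterate_add_apply]
    rcases split _ l0 m0 with h | h
    · exact h
    exfalso
    rcases split _ l1 m1 with g | g
    · rw [v1] at g
      rw [v0, hsplit, g, g] at h
      omega
    · have e : F^[2 ^ n] 0 = F^[2 ^ n] (F^[2 ^ n] 0) := by
        rw [← hsplit, ← v0, ← v1, h, g]
      have := (p0.iterate (2 ^ n)).eq_of_apply_eq_same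
        ((p0.apply_iterate (2 ^ n)).iterate (2 ^ n)) hj e
      rw [← v1, g] at this
      omega

/-- `B_n` is literally a subalgebra of `B_N` for `n ≤ N`. -/
theorem back_eq_of_le {n N : ℕ} (h : n ≤ N) {x y : ℕ} (hx : x < 2 ^ n) (hy : y < 2 ^ n) :
    back N x y = back n x y := by
  induction N, h using Nat.le_induction with
  | base => rfl
  | succ N hN ih =>
    have hle : 2 ^ n ≤ 2 ^ N := Nat.pow_le_pow_right (by norm_num) hN
    have hNN : 2 ^ (N + 1) = 2 ^ N + 2 ^ N := by ring
    rw [← ih]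
    rcases Nat.eq_zero_or_pos x with rfl | h0
    · rw [back_zero, back_zero]
    have m := back_mod_of N (back_right_zero N) x (by omega) (2 ^ (N + 1) - 1 - y) y (by omega)
    have := back_lt (N + 1) h0 y
    rwa [Nat.mod_eq_of_lt (by omega), Nat.mod_eq_of_lt (by omega), Nat.mod_eq_of_lt (by omega)]
      at m

/-- The operation `x ∖ y` of `B_∞`, the union of the increasing chain of algebras `B_n`; its
underlying set is `ℕ`. It is computed in the first `B_n` which contains both `x` and `y`; by
`binf_eq_back` every other `B_n` which contains them gives the same value. -/
def binf (x y : ℕ) : ℕ := back (Nat.size (max x y)) x y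

theorem binf_eq_back {n x y : ℕ} (hx : x < 2 ^ n) (hy : y < 2 ^ n) :
    binf x y = back n x y := by
  have h : max x y < 2 ^ Nat.size (max x y) := Nat.lt_size_self _
  exact (back_eq_of_le (Nat.size_le.2 (max_lt hx hy)) ((le_max_left _ _).trans_lt h)
    ((le_max_right _ _).trans_lt h)).symm

/-- The sequence `x ∖ 0, x ∖ 1, x ∖ 2, …` in `B_∞` is periodic and `p` is its period length, i.e.
its least positive period. -/
def HasPeriodLength (x p : ℕ) : Prop :=
  IsLeast {q : ℕ | 0 < q ∧ ∀ i, binf x (i + q) = binf x i} p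

/-- The number of `1` bits in the binary representation of `x`. -/
def oneBits (x : ℕ) : ℕ := (Nat.digits 2 x).count 1

end Laver

namespace Laver

/-! ### The algebra `B_∞` -/

/-! For `x > 0` the row of `x`, read backwards from a large power of two, is the orbit of `0` under
`z ↦ binf z (x - 1)`. This orbit closes up after `2 ^ M` steps, so the period is a power of two and
the entries in one period are distinct (`exists_row_period`). The row of `x + 1` only uses bits of
`x` (`testBit_binf_succ`), and counting distinct entries gives the upper bound.

With `d = s' - s`, the number in question is `2 ^ s * (2 ^ d - 1) + 1`. It suffices that its row
begins with `2 ^ s * y` for `y < 2 ^ d` (`Shifts s d`): a shorter period would put a zero at some `2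
^ o` with `o < d`. By the composition law `Shifts s D` and `Shifts t d` give `Shifts (s + t) d` if
`t + d ≤ D`, so `s` can be assembled from its binary digits (`shifts_of_dvd`), and only `Shifts t (2
* t)` for `t = 2 ^ k` remains.

This is reached by doubling `t`. A row acts on exponents of `2` ("levels") by a monotone map `img`,
strictly increasing until it hits the truncation `N`; left distributivity becomes `img_binf`. `Jumps
t` and `Reaches t` give `Scales t f` for all `f < 2 ^ (2 * t)`, hence `Shifts t (2 * t)`; this gives
`Reaches (2 * t)`, and then `Jumps (2 * t)` by an extremal argument. -/

theorem exists_two_pow_gt (a : ℕ) : ∃ n : ℕ, a < 2 ^ n := ⟨a, Nat.lt_two_pow_self⟩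

theorem binf_zero (y : ℕ) : binf 0 y = y := back_zero _ _

theorem binf_lt {x : ℕ} (hx : 0 < x) (y : ℕ) : binf x y < x := back_lt _ hx y

theorem binf_succ {x : ℕ} (hx : 0 < x) (y : ℕ) :
    binf x y = binf (binf x (y + 1)) (x - 1) := by
  obtain ⟨n, hn⟩ := exists_two_pow_gt (x + y + 1)
  have h := back_step n hx (Nat.succ_pos y) (by omega)
  have hlt := binf_lt hx (y + 1)
  rw [binf_eq_back (n := n) (by omega) (by omega), binf_eq_back (n := n) (x := binf x (y + 1))
    (by omega) (by omega), binf_eq_back (n := n) (x := x) (y := y + 1) (by omega) (by omega)]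
  exact h

theorem binf_last {n x : ℕ} (hx : 0 < x) (hn : x < 2 ^ n) : binf x (2 ^ n - 1) = x - 1 := by
  rw [binf_eq_back hn (by omega), back_last n hx]

theorem binf_right_zero (x : ℕ) : binf x 0 = 0 := by
  obtain ⟨n, hn⟩ := exists_two_pow_gt x
  rw [binf_eq_back hn (by positivity), back_right_zero n x hn]

/-! ### Reduction modulo powers of two. -/

theorem back_mod {n N : ℕ} (h : n ≤ N) {x y : ℕ} (hx : x < 2 ^ N) (hy : y < 2 ^ N) :
    back N x y % 2 ^ n = back n (x % 2 ^ n) (y % 2 ^ n) := by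
  induction N, h using Nat.le_induction generalizing x y with
  | base =>
    rw [Nat.mod_eq_of_lt hx, Nat.mod_eq_of_lt hy, Nat.mod_eq_of_lt (back_closed n hx hy)]
  | succ N hN ih =>
    have m := back_mod_of N (back_right_zero N) x hx (2 ^ (N + 1) - 1 - y) y (by omega)
    have hd : 2 ^ n ∣ 2 ^ N := pow_dvd_pow 2 hN
    rw [← Nat.mod_mod_of_dvd _ hd, m, ih (Nat.mod_lt _ (by positivity))
      (Nat.mod_lt _ (by positivity)), Nat.mod_mod_of_dvd _ hd, Nat.mod_mod_of_dvd _ hd]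

theorem binf_mod (n x y : ℕ) : binf x y % 2 ^ n = back n (x % 2 ^ n) (y % 2 ^ n) := by
  obtain ⟨N, hN⟩ := exists_two_pow_gt (x + y + 2 ^ n)
  have h : n ≤ N := by
    by_contra hc
    have : 2 ^ N ≤ 2 ^ n := Nat.pow_le_pow_right (by norm_num) (by omega)
    omega
  have hpos : 0 < 2 ^ n := by positivity
  rw [binf_eq_back (n := N) (by omega) (by omega), back_mod h (by omega) (by omega)]

theorem binf_modEq {n x x' y y' : ℕ} (hx : x ≡ x' [MOD 2 ^ n]) (hy : y ≡ y' [MOD 2 ^ n]) :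
    binf x y ≡ binf x' y' [MOD 2 ^ n] := by
  unfold Nat.ModEq at *
  rw [binf_mod, binf_mod, hx, hy]

theorem two_pow_dvd_binf {n : ℕ} (x : ℕ) {y : ℕ} (h : 2 ^ n ∣ y) : 2 ^ n ∣ binf x y := by
  have := binf_modEq (Nat.ModEq.refl x) ((Nat.modEq_zero_iff_dvd).2 h)
  rw [binf_right_zero] at this
  exact (Nat.modEq_zero_iff_dvd).1 this

theorem dvd_binf_congr {n x x' : ℕ} (hx : x ≡ x' [MOD 2 ^ n]) (y : ℕ) :
    2 ^ n ∣ binf x y ↔ 2 ^ n ∣ binf x' y := by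
  rw [← Nat.modEq_zero_iff_dvd, ← Nat.modEq_zero_iff_dvd]
  have := binf_modEq hx (Nat.ModEq.refl y)
  exact ⟨fun h => this.symm.trans h, fun h => this.trans h⟩

theorem binf_eq_zero_of_dvd {n x y : ℕ} (hx0 : 0 < x) (hx : x ≤ 2 ^ n) (h : 2 ^ n ∣ binf x y) :
    binf x y = 0 :=
  Nat.eq_zero_of_dvd_of_lt h ((binf_lt hx0 y).trans_le hx)

/-- Descending induction along a row of `B_∞`. -/
theorem row_induction {P : ℕ → Prop} (base : ∀ n : ℕ, ∃ m ≥ n, P m)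
    (step : ∀ y, P (y + 1) → P y) (y : ℕ) : P y := by
  obtain ⟨m, hm, h⟩ := base y
  exact Nat.decreasingInduction (motive := fun k _ => P k) (fun k _ hk => step k hk) h hm

/-- Left distributivity. -/
theorem binf_distrib (x : ℕ) : ∀ y z, binf x (binf y z) = binf (binf x y) (binf x z) := by
  induction x using Nat.strong_induction_on with
  | _ x ihx =>
  rcases Nat.eq_zero_or_pos x with rfl | hx
  · intro y z; simp only [binf_zero]
  intro y
  induction y using Nat.strong_induction_on with
  | _ y ihy =>
  rcases Nat.eq_zero_or_pos y with rfl | hy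
  · intro z; rw [binf_zero, binf_right_zero, binf_zero]
  apply row_induction
  · intro n
    refine ⟨2 ^ (x + y + n) - 1, ?_, ?_⟩
    · have := Nat.lt_two_pow_self (n := x + y + n); omega
    · have := Nat.lt_two_pow_self (n := x + y + n)
      rw [binf_last hy (by omega), binf_last hx (by omega), binf_succ hx (y - 1),
        Nat.sub_add_cancel hy]
  · intro z hz
    rw [binf_succ hy z, ihy _ (binf_lt hy _), hz, binf_succ hx (y - 1), Nat.sub_add_cancel hy,
      ← ihx _ (binf_lt hx y), ← binf_succ hx z]

/-- The composition law `(x ∘ y) ∖ z = x ∖ (y ∖ z)`, where `x ∘ y = x ∖ (y - 1) + 1`. -/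
theorem binf_comp (x : ℕ) {y : ℕ} (hy : 0 < y) (z : ℕ) :
    binf (binf x (y - 1) + 1) z = binf x (binf y z) := by
  revert z
  apply row_induction
  · intro n
    refine ⟨2 ^ (x + y + n) - 1, ?_, ?_⟩
    · have := Nat.lt_two_pow_self (n := x + y + n); omega
    · have := Nat.lt_two_pow_self (n := x + y + n)
      have hle : binf x (y - 1) + 1 < 2 ^ (x + y + n) := by
        rcases Nat.eq_zero_or_pos x with rfl | hx
        · rw [binf_zero]; omega
        · have := binf_lt hx (y - 1); omega
      rw [binf_last (Nat.succ_pos _) hle, binf_last hy (by omega)]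
      omega
  · intro z hz
    rw [binf_succ (Nat.succ_pos _) z, hz, binf_succ hy z,
      binf_distrib x (binf y (z + 1)) (y - 1), Nat.succ_sub_one]

/-- The entries of the row of `x + 1` are bitwise below `x`. -/
theorem testBit_binf_succ {x y i : ℕ} (h : (binf (x + 1) y).testBit i = true) :
    x.testBit i = true := by
  by_contra hx
  have hx0 : x % 2 ^ (i + 1) < 2 ^ i := by
    refine Nat.lt_pow_two_of_testBit _ fun j hj => ?_
    rw [Nat.testBit_mod_two_pow]
    rcases Nat.lt_or_ge j (i + 1) with h1 | h1
    · obtain rfl : j = i := by omega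
      simpa using hx
    · simp [Nat.not_lt.2 h1]
  have hc : binf (x + 1) y ≡ binf (x % 2 ^ (i + 1) + 1) y [MOD 2 ^ (i + 1)] :=
    binf_modEq ((Nat.mod_modEq x _).symm.add_right 1) (Nat.ModEq.refl y)
  have hlt : binf (x % 2 ^ (i + 1) + 1) y < 2 ^ i := by
    have := binf_lt (x := x % 2 ^ (i + 1) + 1) (Nat.succ_pos _) y
    omega
  have hb : (binf (x + 1) y % 2 ^ (i + 1)).testBit i = true := by
    rw [Nat.testBit_mod_two_pow]; simp [h]
  rw [hc, Nat.testBit_mod_two_pow, Nat.testBit_lt_two_pow hlt] at hb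
  simp at hb

theorem binf_eq_iterate {x M : ℕ} (hx : 0 < x) (hM : x < 2 ^ M) {k : ℕ} (hk : k ≤ 2 ^ M) :
    binf x (2 ^ M - k) = (fun z => binf z (x - 1))^[k] 0 := by
  induction k with
  | zero =>
    have h : 2 ^ M ∣ binf x (2 ^ M) := two_pow_dvd_binf x dvd_rfl
    simpa using binf_eq_zero_of_dvd hx hM.le h
  | succ k ih =>
    rw [Function.iterate_succ_apply', ← ih (by omega), binf_succ hx]
    congr 2
    omega

/-! ### Periodicity and divisibility along a row. -/

/-- A row of `B_∞` is periodic, its minimal period is a power of two, and its entries within one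
period are distinct. -/
theorem exists_row_period {x : ℕ} (hx : 0 < x) :
    ∃ o : ℕ, (∀ y y', binf x y = binf x y' ↔ y ≡ y' [MOD 2 ^ o]) := by
  set F : ℕ → ℕ := fun z => binf z (x - 1) with hF
  obtain ⟨M, hM⟩ := exists_two_pow_gt x
  have per : ∀ m, M ≤ m → F^[2 ^ m] 0 = 0 := by
    intro m hm
    have hle : 2 ^ M ≤ 2 ^ m := Nat.pow_le_pow_right (by norm_num) hm
    have := binf_eq_iterate hx (hM.trans_le hle) le_rfl
    rw [Nat.sub_self, binf_right_zero] at this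
    exact this.symm
  have hP : Function.IsPeriodicPt F (2 ^ M) 0 := per M le_rfl
  obtain ⟨o, ho, hp⟩ := (Nat.dvd_prime_pow Nat.prime_two).1 hP.minimalPeriod_dvd
  have hpos : 0 < Function.minimalPeriod F 0 := by rw [hp]; positivity
  refine ⟨o, fun y y' => ?_⟩
  have hm := Nat.lt_two_pow_self (n := M + y + y')
  set m := M + y + y' with hmdef
  have hle : 2 ^ M ≤ 2 ^ m := Nat.pow_le_pow_right (by norm_num) (by omega)
  have e : ∀ a ≤ 2 ^ m, binf x a = F^[2 ^ m - a] 0 := by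
    intro a ha
    have := binf_eq_iterate hx (hM.trans_le hle) (k := 2 ^ m - a) (by omega)
    rwa [Nat.sub_sub_self ha] at this
  have hdvd : 2 ^ o ∣ 2 ^ m := pow_dvd_pow 2 (by omega)
  rw [e y (by omega), e y' (by omega), ← Function.iterate_mod_minimalPeriod_eq (n := 2 ^ m - y),
    ← Function.iterate_mod_minimalPeriod_eq (n := 2 ^ m - y'),
    Function.iterate_eq_iterate_iff_of_lt_minimalPeriod (Nat.mod_lt _ hpos) (Nat.mod_lt _ hpos),
    hp]
  change 2 ^ m - y ≡ 2 ^ m - y' [MOD 2 ^ o] ↔ _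
  have hy : 2 ^ m - y + y = 2 ^ m := by omega
  have hy' : 2 ^ m - y' + y' = 2 ^ m := by omega
  constructor
  · intro h
    have h2 : 2 ^ m - y + y ≡ 2 ^ m - y' + y' [MOD 2 ^ o] := by rw [hy, hy']
    exact Nat.ModEq.add_left_cancel h h2
  · intro h
    have h2 : 2 ^ m - y + y ≡ 2 ^ m - y' + y' [MOD 2 ^ o] := by rw [hy, hy']
    exact Nat.ModEq.add_right_cancel h h2

theorem exists_binf_eq_zero_iff {x : ℕ} (hx : 0 < x) :
    ∃ o : ℕ, ∀ y, binf x y = 0 ↔ 2 ^ o ∣ y := by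
  obtain ⟨o, ho⟩ := exists_row_period hx
  refine ⟨o, fun y => ?_⟩
  rw [← Nat.modEq_zero_iff_dvd, ← ho, binf_right_zero]

theorem exists_dvd_binf_iff (x m : ℕ) : ∃ o : ℕ, ∀ y, 2 ^ m ∣ binf x y ↔ 2 ^ o ∣ y := by
  rcases Nat.eq_zero_or_pos (x % 2 ^ m) with h | h
  · refine ⟨m, fun y => ?_⟩
    rw [dvd_binf_congr (x' := 0) (by simpa [Nat.ModEq] using h), binf_zero]
  · obtain ⟨o, ho⟩ := exists_binf_eq_zero_iff h
    refine ⟨o, fun y => ?_⟩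
    rw [← ho, dvd_binf_congr (Nat.mod_modEq x (2 ^ m)).symm]
    exact ⟨binf_eq_zero_of_dvd h (Nat.mod_lt _ (by positivity)).le, fun e => by simp [e]⟩

theorem dvd_binf_of_dvd {x m i y : ℕ} (h : 2 ^ m ∣ binf x (2 ^ i)) (hy : 2 ^ i ∣ y) :
    2 ^ m ∣ binf x y := by
  obtain ⟨o, ho⟩ := exists_dvd_binf_iff x m
  exact (ho y).2 (((ho _).1 h).trans hy)

theorem dvd_binf_two_pow {x m i c : ℕ} (h : 2 ^ m ∣ binf x (2 ^ i * c)) (hc : ¬ 2 ∣ c) :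
    2 ^ m ∣ binf x (2 ^ i) := by
  obtain ⟨o, ho⟩ := exists_dvd_binf_iff x m
  refine (ho _).2 (Nat.Coprime.dvd_of_dvd_mul_right ?_ ((ho _).1 h))
  exact Nat.Coprime.pow_left o ((Nat.Prime.coprime_iff_not_dvd Nat.prime_two).2 hc)

/-- Modulo `2 ^ (m + 1)` the entries at `2 ^ i` and `2 ^ (i + 1)` lie in `{0, 2 ^ m}`. If the second
were `2 ^ m`, the first would be nonzero, hence equal to it, against distinctness within a period.
-/
theorem dvd_binf_succ {x m i : ℕ} (h : 2 ^ m ∣ binf x (2 ^ i)) :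
    2 ^ (m + 1) ∣ binf x (2 ^ (i + 1)) := by
  have hm2 : 2 ^ (m + 1) = 2 ^ m + 2 ^ m := by ring
  rcases Nat.eq_zero_or_pos (x % 2 ^ (m + 1)) with h0 | h0
  · have hx : x ≡ 0 [MOD 2 ^ (m + 1)] := by simpa [Nat.ModEq] using h0
    rw [dvd_binf_congr hx, binf_zero]
    rw [dvd_binf_congr (hx.of_dvd (pow_dvd_pow 2 (by omega))), binf_zero] at h
    rw [pow_succ, pow_succ]
    exact Nat.mul_dvd_mul_right h 2
  · obtain ⟨o, ho⟩ := exists_row_period h0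
    set x0 := x % 2 ^ (m + 1)
    have hx : x ≡ x0 [MOD 2 ^ (m + 1)] := (Nat.mod_modEq x _).symm
    have hlt : x0 < 2 ^ (m + 1) := Nat.mod_lt _ (by positivity)
    rw [dvd_binf_congr hx]
    rw [dvd_binf_congr (hx.of_dvd (pow_dvd_pow 2 (by omega)))] at h
    have h' := dvd_binf_of_dvd h (pow_dvd_pow 2 (Nat.le_succ i))
    have two : ∀ z, 2 ^ m ∣ z → z < 2 ^ (m + 1) → z = 0 ∨ z = 2 ^ m := by
      rintro _ ⟨c, rfl⟩ hz
      have : c < 2 := by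
        by_contra hc
        have : 2 ^ m * 2 ≤ 2 ^ m * c := Nat.mul_le_mul_left _ (by omega)
        omega
      interval_cases c <;> simp
    rcases two _ h' ((binf_lt h0 _).trans hlt) with e | e
    · rw [e]; exact dvd_zero _
    exfalso
    have key : ∀ y, binf x0 y = 0 ↔ 2 ^ o ∣ y := fun y => by
      rw [← Nat.modEq_zero_iff_dvd, ← ho, binf_right_zero]
    have h2 : 2 ^ (i + 1) = 2 ^ i + 2 ^ i := by ring
    have hne : ¬ 2 ^ o ∣ 2 ^ i := fun hd => by
      have := (key _).2 (hd.trans (pow_dvd_pow 2 (Nat.le_succ i)))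
      have : 0 < 2 ^ m := by positivity
      omega
    rcases two _ h ((binf_lt h0 _).trans hlt) with e' | e'
    · exact hne ((key _).1 e')
    · have := (ho _ _).1 (e'.trans e.symm)
      rw [h2] at this
      have h3 : 2 ^ i + 0 ≡ 2 ^ i + 2 ^ i [MOD 2 ^ o] := this
      exact hne ((Nat.modEq_zero_iff_dvd).1 (Nat.ModEq.add_left_cancel' _ h3).symm)

/-! ### The action of a row on the levels of divisibility by powers of two -/

/-- The exponent of `2` in `y`, truncated at `N`. -/
def lev (N y : ℕ) : ℕ := Nat.findGreatest (fun m => 2 ^ m ∣ y) N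

theorem lev_le (N y : ℕ) : lev N y ≤ N := Nat.findGreatest_le N

theorem pow_lev_dvd (N y : ℕ) : 2 ^ lev N y ∣ y :=
  Nat.findGreatest_spec (P := fun m => 2 ^ m ∣ y) (Nat.zero_le N) (by simp)

theorem le_lev_iff {N m : ℕ} (h : m ≤ N) (y : ℕ) : m ≤ lev N y ↔ 2 ^ m ∣ y :=
  ⟨fun hm => (pow_dvd_pow 2 hm).trans (pow_lev_dvd N y), fun hm => Nat.le_findGreatest h hm⟩

theorem lev_two_pow {N i : ℕ} (h : i ≤ N) : lev N (2 ^ i) = i := by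
  apply le_antisymm
  · exact (Nat.pow_dvd_pow_iff_le_right (by norm_num)).1 (pow_lev_dvd N (2 ^ i))
  · exact (le_lev_iff h _).2 dvd_rfl

/-- The level to which the row of `x` maps the level `i`. -/
def img (N x i : ℕ) : ℕ := lev N (binf x (2 ^ i))

theorem img_le (N x i : ℕ) : img N x i ≤ N := lev_le _ _

theorem le_img_iff {N m : ℕ} (h : m ≤ N) (x i : ℕ) : m ≤ img N x i ↔ 2 ^ m ∣ binf x (2 ^ i) :=
  le_lev_iff h _

theorem img_mono {N x i j : ℕ} (h : i ≤ j) : img N x i ≤ img N x j :=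
  (le_img_iff (img_le _ _ _) _ _).2 (dvd_binf_of_dvd (pow_lev_dvd _ _) (pow_dvd_pow 2 h))

theorem img_succ {N x i : ℕ} (h : img N x i < N) : img N x i + 1 ≤ img N x (i + 1) :=
  (le_img_iff h _ _).2 (dvd_binf_succ (pow_lev_dvd _ _))

theorem img_add {N x i : ℕ} (k : ℕ) : min N (img N x i + k) ≤ img N x (i + k) := by
  induction k with
  | zero => simp
  | succ k ih =>
    change min N (img N x i + k + 1) ≤ img N x (i + k + 1)
    by_cases h : img N x (i + k) < N
    · have := img_succ h
      omega
    · have : img N x (i + k) ≤ img N x (i + k + 1) := img_mono (Nat.le_succ _)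
      omega

theorem img_lt {N x i j : ℕ} (h : i < j) (hi : img N x i < N) : img N x i < img N x j :=
  (Nat.lt_of_succ_le (img_succ hi)).trans_le (img_mono h)

theorem img_inj {N x i j : ℕ} (hi : img N x i < N) (h : img N x i = img N x j) : i = j := by
  rcases lt_trichotomy i j with hlt | rfl | hlt
  · have := img_lt hlt hi; omega
  · rfl
  · have := img_lt hlt (h ▸ hi); omega

/-- The columns whose entry is divisible by `2 ^ m` are exactly the multiples of some `2 ^ o`, so
only the exponent of `2` in `y` matters. -/
theorem lev_binf (N x y : ℕ) : lev N (binf x y) = img N x (lev N y) := by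
  apply le_antisymm
  · refine (le_img_iff (lev_le _ _) _ _).2 ?_
    rcases (lev_le N y).lt_or_eq with h | h
    · obtain ⟨c, hc⟩ := pow_lev_dvd N y
      have hodd : ¬ 2 ∣ c := by
        rintro ⟨d, rfl⟩
        rw [← mul_assoc, ← pow_succ] at hc
        have : lev N y + 1 ≤ lev N y := (le_lev_iff h y).2 ⟨d, hc⟩
        omega
      have h2 := pow_lev_dvd N (binf x y)
      set m := lev N (binf x y)
      set j := lev N y
      rw [hc] at h2
      exact dvd_binf_two_pow h2 hodd
    · rw [h]
      exact two_pow_dvd_binf x (pow_dvd_pow 2 (lev_le _ _))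
  · exact (le_lev_iff (img_le _ _ _) _).2 (dvd_binf_of_dvd (pow_lev_dvd _ _) (pow_lev_dvd _ _))

/-- Left distributivity seen on levels; the later extremal arguments rest on this identity. -/
theorem img_binf (N x y i : ℕ) : img N (binf x y) (img N x i) = img N x (img N y i) := by
  have h := congrArg (lev N) (binf_distrib x y (2 ^ i))
  exact (lev_binf N _ _).symm.trans (h.symm.trans (lev_binf N _ _))

theorem img_of_lt_lev {N x i : ℕ} (h : i < lev N x) : img N x i = i := by
  have hN := lev_le N x
  have hc : x ≡ 0 [MOD 2 ^ (i + 1)] :=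
    (Nat.modEq_zero_iff_dvd).2 ((le_lev_iff (N := N) (m := i + 1) (by omega) x).1 h)
  apply le_antisymm
  · by_contra hlt
    have := (le_img_iff (N := N) (m := i + 1) (by omega) x i).1 (by omega)
    rw [dvd_binf_congr hc, binf_zero, Nat.pow_dvd_pow_iff_le_right (by norm_num)] at this
    omega
  · exact (le_img_iff (by omega) _ _).2 (two_pow_dvd_binf x dvd_rfl)

/-- At `j = lev N x`, the residue of `x` modulo `2 ^ (j + 1)` is `2 ^ j`, so an entry divisible by
`2 ^ j` and below it vanishes there. `img_add` carries the gain to higher levels. -/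
theorem lt_img {N x i : ℕ} (hi : lev N x ≤ i) (hN : i < N) : i < img N x i := by
  obtain ⟨k, rfl⟩ := Nat.exists_eq_add_of_le hi
  have h : lev N x + 1 ≤ img N x (lev N x) := by
    refine (le_img_iff (N := N) (m := lev N x + 1) (by omega) _ _).2 ?_
    have hnd : ¬ 2 ^ (lev N x + 1) ∣ x := fun h => by
      have := (le_lev_iff (N := N) (m := lev N x + 1) (by omega) x).2 h
      omega
    have hd := pow_lev_dvd N x
    set j := lev N x
    set x0 := x % 2 ^ (j + 1) with hx0
    have hpos : 0 < x0 := Nat.pos_of_ne_zero fun h => hnd (Nat.dvd_of_mod_eq_zero h)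
    have hlt : x0 < 2 ^ (j + 1) := Nat.mod_lt _ (by positivity)
    have hd0 : 2 ^ j ∣ x0 := (Nat.dvd_mod_iff (pow_dvd_pow 2 (Nat.le_succ j))).2 hd
    have hle : x0 ≤ 2 ^ j := by
      obtain ⟨c, hc⟩ := hd0
      have : c < 2 := by
        by_contra h2
        have : 2 ^ j * 2 ≤ 2 ^ j * c := Nat.mul_le_mul_left _ (by omega)
        rw [pow_succ] at hlt
        omega
      interval_cases c <;> omega
    rw [dvd_binf_congr (Nat.mod_modEq x _).symm, binf_eq_zero_of_dvd hpos hle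
      (two_pow_dvd_binf _ dvd_rfl)]
    exact dvd_zero _
  have := img_add (N := N) (x := x) (i := lev N x) k
  omega

theorem lev_le_of_lt_img {N x i : ℕ} (h : i < img N x i) : lev N x ≤ i := by
  by_contra hc
  have := img_of_lt_lev (not_le.1 hc)
  omega

theorem lev_lt_iff {N t : ℕ} (h : t ≤ N) (x : ℕ) : lev N x < t ↔ ¬ 2 ^ t ∣ x := by
  rw [← le_lev_iff h, not_le]

theorem binf_eq_zero_of_img {N x i : ℕ} (hx : 0 < x) (hN : x ≤ 2 ^ N) (h : img N x i = N) :
    binf x (2 ^ i) = 0 :=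
  binf_eq_zero_of_dvd hx hN ((le_img_iff le_rfl _ _).1 h.ge)

/-! ### Rows which jump over a block of levels -/

/-- Every row which moves some level below `t` maps the level `t` to at least `2 * t`. -/
def Jumps (t : ℕ) : Prop := ∀ x, ¬ 2 ^ t ∣ x → 2 ^ (2 * t) ∣ binf x (2 ^ t)

/-- Every level strictly between `0` and `t` is mapped to `t` by a row which moves some level
strictly below it. -/
def Reaches (t : ℕ) : Prop :=
  ∀ N i, t < N → 0 < i → i < t → ∃ z, lev N z < i ∧ img N z i = t

/-- The row of `2 ^ s * (2 ^ d - 1) + 1` starts with the multiples of `2 ^ s`. -/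
def Shifts (s d : ℕ) : Prop := ∀ y < 2 ^ d, binf (2 ^ s * (2 ^ d - 1) + 1) y = 2 ^ s * y

/-- Multiplication of rows by `2 ^ t` is compatible with the operation of `B_∞`, for the row `f`. -/
def Scales (t f : ℕ) : Prop :=
  ∀ u, ∀ w < 2 ^ t, binf (2 ^ t * f) (2 ^ t * u + w) = 2 ^ t * binf f u + w

theorem Jumps.min_le_img {N t x : ℕ} (h : Jumps t) (ht : t ≤ N) (hx : lev N x < t) :
    min N (2 * t) ≤ img N x t :=
  (le_img_iff (min_le_left _ _) _ _).2
    ((pow_dvd_pow 2 (min_le_right _ _)).trans (h x ((lev_lt_iff ht x).1 hx)))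

theorem jumps_one : Jumps 1 := by
  intro x hx
  have h1 : lev 2 x < 1 := (lev_lt_iff (by norm_num) x).2 hx
  have h2 : 1 < img 2 x 1 := lt_img (by omega) (by norm_num)
  exact (le_img_iff (N := 2) le_rfl x 1).1 h2

theorem reaches_one : Reaches 1 := by
  intro N i _ h1 h2; omega

theorem Shifts.img_eq {s d N a : ℕ} (h : Shifts s d) (ha : a < d) (hN : s + a ≤ N) :
    img N (2 ^ s * (2 ^ d - 1) + 1) a = s + a := by
  unfold img
  rw [h _ (Nat.pow_lt_pow_right (by norm_num) ha), ← pow_add, lev_two_pow hN]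

/-- The row `e` raises each level `a ≤ t` to `t + a`. If `i < t`, compose `e` after a row taking `i`
to `t`; if `i = t`, use `e` itself; if `i > t`, apply `e` to a row taking `i - t` to `t`. -/
theorem Reaches.double {t : ℕ} (ht : 0 < t) (hG : Reaches t) (hE : Shifts t (2 * t)) :
    Reaches (2 * t) := by
  intro N i hN h0 hi
  set e := 2 ^ t * (2 ^ (2 * t) - 1) + 1 with he
  have himg : ∀ a, a ≤ t → img N e a = t + a := fun a ha => hE.img_eq (by omega) (by omega)
  rcases lt_trichotomy i t with h | rfl | h
  · obtain ⟨z, hz, hzi⟩ := hG N i (by omega) h0 h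
    have hz0 : 0 < z := Nat.pos_of_ne_zero fun hz0 => by
      have : N ≤ lev N z := (le_lev_iff le_rfl z).2 (by simp [hz0])
      omega
    have hc : ∀ j, img N (binf e (z - 1) + 1) j = img N e (img N z j) := by
      intro j
      have h1 : img N (binf e (z - 1) + 1) j = lev N (binf e (binf z (2 ^ j))) :=
        congrArg (lev N) (binf_comp e hz0 (2 ^ j))
      rw [h1, lev_binf]
      rfl
    refine ⟨binf e (z - 1) + 1, ?_, ?_⟩
    · have h1 : i - 1 < img N z (i - 1) := lt_img (by omega) (by omega)
      have h2 := img_mono (N := N) (x := e) (show i ≤ img N z (i - 1) by omega)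
      rw [himg i h.le, ← hc] at h2
      have := lev_le_of_lt_img (N := N) (x := binf e (z - 1) + 1) (i := i - 1) (by omega)
      omega
    · rw [hc, hzi, himg t le_rfl]; omega
  · refine ⟨e, ?_, by rw [himg i le_rfl]; omega⟩
    have := lev_le_of_lt_img (N := N) (x := e) (i := 0) (by rw [himg 0 (by omega)]; omega)
    omega
  · obtain ⟨z, hz, hzi⟩ := hG N (i - t) (by omega) (by omega) (by omega)
    refine ⟨binf e z, ?_, ?_⟩
    · rw [lev_binf, himg _ (by omega)]; omega
    · have := img_binf N e z (i - t)
      rw [himg _ (by omega), hzi, himg _ le_rfl] at this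
      rw [show i = t + (i - t) by omega, this]; omega

/-- A bounded measure attains its maximum. -/
theorem exists_max_of_bdd {α : Type*} {P : α → Prop} (f : α → ℕ) (B : ℕ) (hB : ∀ a, P a → f a ≤ B)
    (h : ∃ a, P a) : ∃ a, P a ∧ ∀ b, P b → f b ≤ f a := by
  obtain ⟨a, ha⟩ := h
  induction hk : B - f a using Nat.strong_induction_on generalizing a with
  | _ k ih =>
    by_cases hmax : ∀ b, P b → f b ≤ f a
    · exact ⟨a, ha, hmax⟩
    · push Not at hmax
      obtain ⟨b, hb, hlt⟩ := hmax
      have := hB b hb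
      exact ih (B - f b) (by omega) b hb rfl

/-! ### Doubling of `Jumps` through minimal counterexamples. -/

section Doubling

variable {s N b : ℕ}

/-- The rows at which `Jumps (2 * s)` fails with a given value. -/
def Stops (s N b x : ℕ) : Prop := lev N x < 2 * s ∧ img N x (2 * s) = b

/-- A row stopping the level `2 * s` at the least possible place maps some level to `2 * s`. -/
theorem Stops.exists_img_eq (hs : 0 < s) (hN : N = 4 * s) (hb : b < N) (hG : Reaches (2 * s))
    (hE : Shifts s (2 * s)) (hmin : ∀ w, lev N w < 2 * s → img N w (2 * s) ≤ b → Stops s N b w)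
    {x : ℕ} (hx : Stops s N b x) (hsx : s ≤ lev N x) :
    ∃ i, s < i ∧ i < 2 * s ∧ img N x i = 2 * s := by
  obtain ⟨hxt, hxb⟩ := hx
  set e := 2 ^ s * (2 ^ (2 * s) - 1) + 1 with he
  have himg : ∀ a, a ≤ s → img N e a = s + a := fun a ha => hE.img_eq (by omega) (by omega)
  have hex : ∃ i, 2 * s ≤ img N x i := ⟨2 * s - 1, by
    have := lt_img (N := N) (x := x) (i := 2 * s - 1) (by omega) (by omega)
    omega⟩
  classical
  set i := Nat.find hex with hi
  have hi1 : 2 * s ≤ img N x i := Nat.find_spec hex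
  have hi2 : ∀ j < i, img N x j < 2 * s := fun j hj => not_le.1 (Nat.find_min hex hj)
  have hi3 : lev N x ≤ i := by
    by_contra hc
    rw [img_of_lt_lev (not_le.1 hc)] at hi1
    omega
  have hi4 : i < 2 * s := by
    have : i ≤ 2 * s - 1 := Nat.find_min' hex (by
      have := lt_img (N := N) (x := x) (i := 2 * s - 1) (by omega) (by omega)
      omega)
    omega
  -- If `i = s`, the row of `binf x e` sends level `0` to at least `2 * s`, hence `2 * s` to at
  -- least `4 * s = N`; but it sends `2 * s` to at most `b < N`.
  have hne : i ≠ s := by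
    intro his
    rw [his] at hi1
    have h0 := img_binf N x e 0
    have h1 := img_binf N x e s
    rw [himg 0 (by omega), img_of_lt_lev (show 0 < lev N x by omega), add_zero] at h0
    rw [himg s le_rfl, ← two_mul, hxb] at h1
    have h2 := img_mono (N := N) (x := binf x e) hi1
    have h3 := img_add (N := N) (x := binf x e) (i := 0) (2 * s)
    rw [zero_add] at h3
    omega
  -- The row of `binf x z` takes `img N x i` to `b`. By minimality of `b` it already takes `2 * s`
  -- to `b`, and strict monotonicity forces `img N x i = 2 * s`.
  obtain ⟨z, hz, hzi⟩ := hG N i (by omega) (by omega) hi4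
  have h1 := img_binf N x z i
  rw [hzi, hxb] at h1
  have h2 := img_mono (N := N) (x := binf x z) hi1
  have h3 := hmin (binf x z) (by rw [lev_binf]; exact hi2 _ hz) (by omega)
  refine ⟨i, by omega, hi4, ?_⟩
  by_contra hc
  have := img_lt (N := N) (x := binf x z) (i := 2 * s) (j := img N x i) (by omega)
    (by rw [h3.2]; exact hb)
  rw [h1, h3.2] at this
  omega

/-- Two extremal choices clash. Among stopping rows of level at least `s` whose first moved level
goes to `2 * s`, take that level `i` least; among rows `z` taking `i` to `2 * s` with `lev N z < i`,
take `lev N z` greatest. Then `binf x z` or `binf z z` violates one of the choices. -/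
theorem Stops.lev_lt (hs : 0 < s) (hN : N = 4 * s) (hb : b < N) (hT : Jumps s)
    (hG : Reaches (2 * s)) (hE : Shifts s (2 * s))
    (hmin : ∀ w, lev N w < 2 * s → img N w (2 * s) ≤ b → Stops s N b w)
    {x : ℕ} (hx : Stops s N b x) : lev N x < s := by
  by_contra hsx
  have key : ∀ x, Stops s N b x ∧ s ≤ lev N x → ∃ i, s < i ∧ i < 2 * s ∧ img N x i = 2 * s :=
    fun x hx => hx.1.exists_img_eq hs hN hb hG hE hmin hx.2
  -- Some row stopping at the level has `2 * s` as the image of the first level it moves.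
  have hS : ∃ i, ∃ x, (Stops s N b x ∧ s ≤ lev N x) ∧ lev N x = i ∧ img N x i = 2 * s := by
    obtain ⟨x, hx, hmax⟩ := exists_max_of_bdd (P := fun x => Stops s N b x ∧ s ≤ lev N x)
      (lev N) N (fun a _ => lev_le N a) ⟨x, hx, not_lt.1 hsx⟩
    obtain ⟨i, hi1, hi2, hxi⟩ := key x hx
    have hle : lev N x ≤ i := lev_le_of_lt_img (by omega)
    rcases hle.lt_or_eq with h | h
    -- Here `binf x x` also stops, at a strictly higher level than `x`.
    · exfalso
      have h1 : lev N (binf x x) = img N x (lev N x) := lev_binf N x x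
      have h2 : lev N x < img N x (lev N x) := lt_img le_rfl (by omega)
      have h3 : img N x (lev N x) < img N x i := img_lt h (by
        have := img_mono (N := N) (x := x) hle; omega)
      have h4 := img_binf N x x i
      rw [hxi, hx.1.2] at h4
      have := hmax (binf x x) ⟨⟨by omega, h4⟩, by have := hx.2; omega⟩
      omega
    · exact ⟨i, x, hx, h, hxi⟩
  classical
  obtain ⟨x, hx, hxl, hxi⟩ := Nat.find_spec hS
  have hleast := fun j (hj : j < Nat.find hS) => Nat.find_min hS hj
  set i := Nat.find hS with hi
  have hi2 : i < 2 * s := hxl ▸ hx.1.1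
  have hi1 : s < i := by
    obtain ⟨j, hj1, hj2, hj3⟩ := key x hx
    have : i = j := img_inj (N := N) (by omega) (hxi.trans hj3.symm)
    omega
  obtain ⟨z, ⟨hz, hzi⟩, hzmax⟩ := exists_max_of_bdd
    (P := fun z => lev N z < i ∧ img N z i = 2 * s) (lev N) N (fun a _ => lev_le N a)
    (hG N i (by omega) (by omega) hi2)
  -- Otherwise `Jumps s` sends `s` to at least `2 * s`, leaving no room for `i > s` to go to `2 *
  -- s`.
  have hsz : s ≤ lev N z := by
    by_contra hc
    have h1 := hT.min_le_img (N := N) (x := z) (by omega) (not_le.1 hc)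
    have h2 := img_lt (N := N) (x := z) (i := s) (j := i) hi1 (by
      have := img_mono (N := N) (x := z) hi1.le; omega)
    omega
  have hlow : ∀ j < i, img N x j = j := fun j hj => img_of_lt_lev (by omega)
  have hw : Stops s N b (binf x z) ∧ s ≤ lev N (binf x z) := by
    rw [lev_binf, hlow _ hz]
    refine ⟨⟨by rw [lev_binf, hlow _ hz]; omega, ?_⟩, hsz⟩
    have := img_binf N x z i
    rwa [hzi, hxi, hx.1.2] at this
  obtain ⟨a, ha1, ha2, ha⟩ := key _ hw
  have hai : a < i := by
    have h1 : i - 1 < img N z (i - 1) := lt_img (by omega) (by omega)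
    have h2 := img_mono (N := N) (x := x) (show i ≤ img N z (i - 1) by omega)
    rw [hxi, ← img_binf, hlow _ (by omega), ← ha] at h2
    by_contra hc
    have := img_lt (N := N) (x := binf x z) (show i - 1 < a by omega) (by
      have := img_mono (N := N) (x := binf x z) (show i - 1 ≤ a by omega)
      omega)
    omega
  have hza : img N z a = i := by
    have h1 := img_binf N x z a
    rw [hlow a hai, ha, ← hxi] at h1
    exact (img_inj (by omega) h1).symm
  have hle : lev N z ≤ a := lev_le_of_lt_img (by omega)
  rcases hle.lt_or_eq with h | h
  · have h1 : lev N (binf z z) = img N z (lev N z) := lev_binf N z z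
    have h2 : lev N z < img N z (lev N z) := lt_img le_rfl (by omega)
    have h3 : img N z (lev N z) < img N z a := img_lt h (by
      have := img_mono (N := N) (x := z) hle; omega)
    have h4 := img_binf N z z a
    rw [hza, hzi] at h4
    have := hzmax (binf z z) ⟨by omega, h4⟩
    omega
  · exact hleast a hai ⟨binf x z, hw, by rw [lev_binf, hlow _ hz, h], ha⟩

/-- Let `b < N` be the least image of `2 * s` in a failing case. If `x` stops there, so does `binf x
e`, and `img N x s = 2 * s`. Using this for `x'` and again for `binf x' e` forces `img N x' 0 = s`,
whereas `Stops.lev_lt` gives `img N x' 0 < s`. -/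
theorem Jumps.double (hs : 0 < s) (hT : Jumps s) (hG : Reaches (2 * s))
    (hE : Shifts s (2 * s)) : Jumps (2 * s) := by
  intro x hx
  set N := 4 * s with hN
  by_contra hcon
  have hlev : lev N x < 2 * s := (lev_lt_iff (by omega) x).2 hx
  have hlt : img N x (2 * s) < N := by
    by_contra hc
    have := (le_img_iff (N := N) le_rfl x (2 * s)).1 (not_lt.1 hc)
    rw [show 2 * (2 * s) = N by omega] at hcon
    exact hcon this
  have hex : ∃ b, ∃ x, Stops s N b x := ⟨_, x, hlev, rfl⟩
  classical
  set b := Nat.find hex with hbdef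
  obtain ⟨x', hx'⟩ := Nat.find_spec hex
  have hb : b < N := lt_of_le_of_lt (Nat.find_min' hex ⟨x, hlev, rfl⟩) hlt
  have hmin : ∀ w, lev N w < 2 * s → img N w (2 * s) ≤ b → Stops s N b w := fun w hw hwb =>
    ⟨hw, le_antisymm hwb (Nat.find_min' hex ⟨w, hw, rfl⟩)⟩
  have hII : ∀ x, Stops s N b x → lev N x < s := fun x hx =>
    hx.lev_lt hs hN hb hT hG hE hmin
  set e := 2 ^ s * (2 ^ (2 * s) - 1) + 1 with he
  have himg : ∀ a, a ≤ s → img N e a = s + a := fun a ha => hE.img_eq (by omega) (by omega)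
  have he0 : lev N e = 0 := by
    have := lev_le_of_lt_img (N := N) (x := e) (i := 0) (by rw [himg 0 (by omega)]; omega)
    omega
  have step : ∀ x, Stops s N b x → Stops s N b (binf x e) ∧ img N x s = 2 * s := by
    intro x hx
    have h1 := hT.min_le_img (N := N) (by omega) (hII x hx)
    have h2 := img_binf N x e s
    rw [himg s le_rfl, ← two_mul, hx.2] at h2
    have h3 := img_mono (N := N) (x := binf x e) (show 2 * s ≤ img N x s by omega)
    have h4 : img N x 0 < 2 * s := by
      by_contra hc
      have := img_add (N := N) (x := x) (i := 0) (2 * s)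
      rw [zero_add, hx.2] at this
      omega
    have h5 := hmin (binf x e) (by rw [lev_binf, he0]; exact h4) (by omega)
    refine ⟨h5, ?_⟩
    by_contra hc
    have := img_lt (N := N) (x := binf x e) (i := 2 * s) (j := img N x s) (by omega)
      (by rw [h5.2]; exact hb)
    rw [h2, h5.2] at this
    omega
  obtain ⟨hw, hxs⟩ := step x' hx'
  have hws := (step _ hw).2
  have hl := hII _ hw
  rw [lev_binf, he0] at hl
  have h0 := img_binf N x' e 0
  rw [himg 0 (by omega), add_zero, hxs] at h0
  have := img_inj (N := N) (by omega) (h0.trans hws.symm)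
  omega

end Doubling

/-! ### Scaling rows by a power of two -/

theorem testBit_eq_false_iff {x i : ℕ} : x.testBit i = false ↔ x / 2 ^ i % 2 = 0 := by
  rw [Nat.testBit_eq_decide_div_mod_eq]
  simp

theorem testBit_pred {x t : ℕ} (h : ¬ 2 ^ t ∣ x) : (x - 1).testBit t = x.testBit t := by
  rw [Nat.testBit_eq_decide_div_mod_eq, Nat.testBit_eq_decide_div_mod_eq]
  have hr : 0 < x % 2 ^ t := Nat.pos_of_ne_zero fun h0 => h (Nat.dvd_of_mod_eq_zero h0)
  have hlt : x % 2 ^ t < 2 ^ t := Nat.mod_lt _ (by positivity)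
  have hx := Nat.div_add_mod x (2 ^ t)
  have : (x - 1) / 2 ^ t = x / 2 ^ t := by
    rw [show x - 1 = (x % 2 ^ t - 1) + 2 ^ t * (x / 2 ^ t) by omega,
      Nat.add_mul_div_left _ _ (by positivity), Nat.div_eq_of_lt (by omega), zero_add]
  rw [this]

theorem testBit_of_dvd_of_not_dvd {x t : ℕ} (h : 2 ^ t ∣ x) (h' : ¬ 2 ^ (t + 1) ∣ x) :
    x.testBit t = true := by
  by_contra hc
  rw [Bool.not_eq_true, testBit_eq_false_iff] at hc
  obtain ⟨c, rfl⟩ := h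
  rw [Nat.mul_div_cancel_left _ (by positivity)] at hc
  rw [pow_succ] at h'
  exact h' (Nat.mul_dvd_mul_left _ (Nat.dvd_of_mod_eq_zero hc))

theorem testBit_two_pow_mul_odd_pred (m q : ℕ) : (2 ^ m * (2 * q + 1) - 1).testBit m = false := by
  rw [testBit_eq_false_iff]
  have hpos : 0 < 2 ^ m := by positivity
  have e : 2 ^ m * (2 * q + 1) - 1 = (2 ^ m - 1) + 2 ^ m * (2 * q) := by
    rw [mul_add, mul_one]; omega
  rw [e, Nat.add_mul_div_left _ _ hpos, Nat.div_eq_of_lt (by omega)]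
  omega

theorem not_dvd_succ_of_testBit {g m : ℕ} (h : g.testBit m = false) : ¬ 2 ^ (m + 1) ∣ g + 1 := by
  rintro ⟨q, hq⟩
  rw [testBit_eq_false_iff] at h
  have hpos : 0 < 2 ^ m := by positivity
  obtain ⟨p, rfl⟩ : ∃ p, q = p + 1 := ⟨q - 1, by
    rcases q with _ | q
    · simp at hq
    · simp⟩
  have e : g = (2 ^ m - 1) + 2 ^ m * (2 * p + 1) := by
    have : 2 ^ (m + 1) * (p + 1) = 2 ^ m * (2 * p + 1) + 2 ^ m := by ring
    omega
  rw [e, Nat.add_mul_div_left _ _ hpos, Nat.div_eq_of_lt (by omega)] at h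
  omega

theorem binf_eq_zero_of_eq_zero {x a y : ℕ} (hx : 0 < x) (h : binf x a = 0) (hy : a ∣ y) :
    binf x y = 0 := by
  obtain ⟨o, ho⟩ := exists_binf_eq_zero_iff hx
  exact (ho y).2 (((ho a).1 h).trans hy)

theorem modEq_one_of_dvd_binf {k x : ℕ} (hk : 0 < k) (h : 2 ^ k ∣ binf x 1) :
    x ≡ 1 [MOD 2 ^ k] := by
  have hk2 : 2 ^ 1 ≤ 2 ^ k := Nat.pow_le_pow_right (by norm_num) hk
  have hx : x ≡ x % 2 ^ k [MOD 2 ^ k] := (Nat.mod_modEq x _).symm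
  have hlt : x % 2 ^ k < 2 ^ k := Nat.mod_lt _ (by positivity)
  rw [dvd_binf_congr hx] at h
  rcases Nat.eq_zero_or_pos (x % 2 ^ k) with h0 | h0
  · rw [h0, binf_zero] at h
    have := Nat.le_of_dvd one_pos h
    omega
  · have h1 := binf_eq_zero_of_eq_zero h0 (binf_eq_zero_of_dvd h0 hlt.le h)
      (one_dvd (2 ^ k - 1))
    rw [binf_last h0 hlt] at h1
    rwa [show x % 2 ^ k = 1 by omega] at hx

theorem binf_two_pow_mul_succ {t g : ℕ} (h : ∀ f ≤ g, Scales t f) (y : ℕ) :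
    binf (2 ^ t * g + 1) y = 2 ^ t * binf (g + 1) y := by
  revert y
  apply row_induction
  · intro n
    have hM := Nat.lt_two_pow_self (n := 2 ^ t * g + g + n + 1)
    refine ⟨2 ^ (2 ^ t * g + g + n + 1) - 1, by omega, ?_⟩
    rw [binf_last (Nat.succ_pos _) (by omega), binf_last (Nat.succ_pos _) (by omega)]
    simp
  · intro y hy
    have hle : binf (g + 1) (y + 1) ≤ g := Nat.le_of_lt_succ (binf_lt (Nat.succ_pos g) _)
    have := h _ hle g 0 (by positivity)
    rw [add_zero, add_zero] at this
    rw [binf_succ (Nat.succ_pos _) y, hy, Nat.succ_sub_one, this,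
      binf_succ (Nat.succ_pos g) y, Nat.succ_sub_one]

/-- Let `i` be the least level sent to `t` or higher. If `i > 0`, a row `z` taking `i` to `t` makes
`binf x z` a smaller instance, whose vanishing at `2 ^ t` transfers back to `x`. If `i = 0`, the row
is a multiple of an odd row, where `Jumps t` applies. -/
theorem binf_two_pow_eq_zero {t c : ℕ} (ht : 0 < t) (hT : Jumps t) (hG : Reaches t)
    (hc : c ≤ 2 ^ (2 * t)) (hQ : ∀ f < c, Scales t f) (x : ℕ) :
    x < 2 ^ t * c → ¬ 2 ^ t ∣ x → x.testBit t = false → binf x (2 ^ t) = 0 := by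
  induction x using Nat.strong_induction_on with
  | _ x ih =>
  intro hxc hxt hbit
  have hx0 : 0 < x := Nat.pos_of_ne_zero fun h => hxt (by simp [h])
  set N := 3 * t with hN
  have hxN : x ≤ 2 ^ N := by
    have : 2 ^ t * c ≤ 2 ^ t * 2 ^ (2 * t) := Nat.mul_le_mul_left _ hc
    rw [← pow_add, show t + 2 * t = N by omega] at this
    omega
  refine binf_eq_zero_of_img hx0 hxN ?_
  have hlev : lev N x < t := (lev_lt_iff (by omega) x).2 hxt
  by_contra hne
  have hbig : 2 * t ≤ img N x t := by
    have := hT.min_le_img (N := N) (by omega) hlev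
    omega
  have hex : ∃ i, t ≤ img N x i := ⟨t, by omega⟩
  classical
  set i := Nat.find hex with hi
  have hi1 : t ≤ img N x i := Nat.find_spec hex
  have hi2 : ∀ j < i, img N x j < t := fun j hj => not_le.1 (Nat.find_min hex hj)
  have hi4 : i < t := by
    have : i ≤ t - 1 := Nat.find_min' hex (by
      have := lt_img (N := N) (x := x) (i := t - 1) (by omega) (by omega)
      omega)
    omega
  have hsub : ∀ y, (binf x y).testBit t = false := by
    intro y
    by_contra hcon
    rw [Bool.not_eq_false, show x = x - 1 + 1 by omega] at hcon
    have := testBit_binf_succ hcon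
    rw [testBit_pred hxt, hbit] at this
    exact absurd this (by simp)
  -- No entry of the row has bit `t`, so exact level `t` is excluded. The extra unit makes the
  -- quotient `2 * h` even when `i = 0`.
  have hi5 : t + 1 ≤ img N x i := by
    by_contra hcon
    have h1 := (le_img_iff (N := N) (m := t) (by omega) x i).1 hi1
    have h2 := mt (le_img_iff (N := N) (m := t + 1) (by omega) x i).2 hcon
    have h3 := testBit_of_dvd_of_not_dvd h1 h2
    rw [hsub] at h3
    exact absurd h3 (by simp)
  rcases Nat.eq_zero_or_pos i with h0 | h0
  · rw [h0] at hi5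
    have h1 := (le_img_iff (N := N) (m := t + 1) (by omega) x 0).1 hi5
    have h2 : x ≡ 1 [MOD 2 ^ (t + 1)] := modEq_one_of_dvd_binf (Nat.succ_pos t) h1
    have h3 := (Nat.modEq_iff_dvd' hx0).1 h2.symm
    obtain ⟨h, hh⟩ := h3
    have hxg : x = 2 ^ t * (2 * h) + 1 := by
      have : 2 ^ (t + 1) * h = 2 ^ t * (2 * h) := by ring
      omega
    have hgc : 2 * h < c := by
      have : 2 ^ t * (2 * h) < 2 ^ t * c := by omega
      exact lt_of_mul_lt_mul_left this (Nat.zero_le _)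
    have h4 := binf_two_pow_mul_succ (fun f hf => hQ f (by omega)) (2 ^ t) (g := 2 * h)
    rw [← hxg] at h4
    have h5 : binf (2 * h + 1) (2 ^ t) = 0 := by
      refine binf_eq_zero_of_dvd (Nat.succ_pos _) (by omega) (hT _ fun hd => ?_)
      have := (dvd_pow_self 2 ht.ne').trans hd
      omega
    apply hne
    unfold img
    rw [h4, h5, mul_zero]
    exact le_antisymm (lev_le _ _) ((le_lev_iff le_rfl _).2 (dvd_zero _))
  · obtain ⟨z, hz, hzi⟩ := hG N i (by omega) h0 hi4
    have h1 := img_binf N x z i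
    rw [hzi] at h1
    have h2 : lev N (binf x z) < t := by rw [lev_binf]; exact hi2 _ hz
    have h3 := ih (binf x z) (binf_lt hx0 z) ((binf_lt hx0 z).trans hxc)
      ((lev_lt_iff (by omega) _).1 h2) (hsub z)
    have h4 : N ≤ img N (binf x z) t :=
      (le_img_iff le_rfl _ _).2 (by rw [h3]; exact dvd_zero _)
    have h5 := img_mono (N := N) (x := binf x z) hi1
    have := img_le N x t
    omega

theorem not_two_pow_dvd {t g w : ℕ} (h0 : 0 < w) (hw : w < 2 ^ t) : ¬ 2 ^ t ∣ 2 ^ t * g + w :=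
  fun h => Nat.not_dvd_of_pos_of_lt h0 hw ((Nat.dvd_add_right (Nat.dvd_mul_right _ _)).1 h)

/-- The row is the composite of the rows of `2 ^ t * (g + 1)` and `b`. By `Jumps t` the row of `b`
sends `2 ^ t` to a multiple of `2 ^ (2 * t)`, which the row of `2 ^ t * (g + 1)` kills: the zero bit
of `g` keeps `2 ^ t` from dividing `g + 1`. -/
theorem binf_two_pow_mul_add_eq_zero {t g w m : ℕ} (hT : Jumps t) (hg : g + 1 < 2 ^ (2 * t))
    (hQ : Scales t (g + 1)) (hm : m < t) (hbit : g.testBit m = false) (h0 : 0 < w)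
    (hw : w < 2 ^ t) : binf (2 ^ t * g + w) (2 ^ t) = 0 := by
  have hY := hQ (2 ^ (2 * t) - 1) (w - 1) (by omega)
  rw [binf_last (Nat.succ_pos g) hg, Nat.succ_sub_one] at hY
  set b := 2 ^ t * (2 ^ (2 * t) - 1) + w with hb
  rw [show 2 ^ t * (2 ^ (2 * t) - 1) + (w - 1) = b - 1 by omega] at hY
  have hcomp := binf_comp (2 ^ t * (g + 1)) (y := b) (by omega) (2 ^ t)
  rw [hY, show 2 ^ t * g + (w - 1) + 1 = 2 ^ t * g + w by omega] at hcomp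
  rw [hcomp]
  have hbt : 2 ^ (2 * t) ∣ binf b (2 ^ t) := hT b (not_two_pow_dvd h0 hw)
  have hpos : 0 < 2 ^ t * (g + 1) := by positivity
  refine binf_eq_zero_of_eq_zero hpos ?_ hbt
  have h1 := hQ (2 ^ t) 0 (by positivity)
  rw [add_zero, add_zero, ← pow_add, ← two_mul] at h1
  rw [h1, binf_eq_zero_of_dvd (Nat.succ_pos g) hg.le (hT _ fun hd => ?_), mul_zero]
  exact not_dvd_succ_of_testBit hbit ((pow_dvd_pow 2 hm).trans hd)

/-- This vanishing makes the entry one column earlier the predecessor of the row index, which drives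
the recursion for `Scales t c`. Writing `c = 2 ^ m * (2 * q + 1)`, the entry `g` lies bitwise below
`c - 1` and so lacks bit `m`. -/
theorem binf_two_pow_mul_last {t c u w : ℕ} (ht : 0 < t) (hT : Jumps t) (hG : Reaches t)
    (hc0 : 0 < c) (hc : c < 2 ^ (2 * t)) (hQ : ∀ f < c, Scales t f) (h0 : 0 < w) (hw : w < 2 ^ t) :
    binf (2 ^ t * binf c u + w) (2 ^ t * c) = 0 := by
  set g := binf c u with hg
  have hgc : g < c := binf_lt hc0 u
  have hxpos : 0 < 2 ^ t * g + w := by omega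
  have hxlt : 2 ^ t * g + w < 2 ^ t * c := by
    have : 2 ^ t * (g + 1) ≤ 2 ^ t * c := Nat.mul_le_mul_left _ hgc
    rw [mul_add, mul_one] at this
    omega
  have hxt := not_two_pow_dvd (g := g) h0 hw
  obtain ⟨m, c', hodd, hcm⟩ := Nat.exists_eq_two_pow_mul_odd hc0.ne'
  obtain ⟨q, rfl⟩ := hodd
  have hbit : g.testBit m = false := by
    by_contra hcon
    rw [Bool.not_eq_false, hg, show c = c - 1 + 1 by omega] at hcon
    have := testBit_binf_succ hcon
    rw [hcm, testBit_two_pow_mul_odd_pred] at this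
    exact absurd this (by simp)
  suffices h : binf (2 ^ t * g + w) (2 ^ (t + m)) = 0 from
    binf_eq_zero_of_eq_zero hxpos h ⟨2 * q + 1, by rw [pow_add, mul_assoc, ← hcm]⟩
  rcases Nat.eq_zero_or_pos q with hq | hq
  · have e : 2 ^ t * c = 2 ^ (t + m) := by rw [hcm, hq, pow_add]; ring
    exact binf_eq_zero_of_dvd hxpos (by omega) (two_pow_dvd_binf _ dvd_rfl)
  set d := Nat.log 2 c with hd
  have hd1 : 2 ^ d ≤ c := Nat.pow_log_le_self 2 hc0.ne'
  have hd2 : c < 2 ^ (d + 1) := Nat.lt_pow_succ_log_self (by norm_num) c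
  have hd3 : d < 2 * t := (Nat.pow_lt_pow_iff_right (by norm_num)).1 (hd1.trans_lt hc)
  have hmd : m < d := by
    have h1 : 2 ^ (m + 1) ≤ c := by
      rw [hcm, pow_succ]; exact Nat.mul_le_mul_left _ (by omega)
    have := (Nat.pow_lt_pow_iff_right (a := 2) (by norm_num)).1 (h1.trans_lt hd2)
    omega
  set N := t + d + 1 with hN
  have hxN : 2 ^ t * g + w ≤ 2 ^ N := by
    have : 2 ^ t * c ≤ 2 ^ t * 2 ^ (d + 1) := Nat.mul_le_mul_left _ hd2.le
    have e : 2 ^ t * 2 ^ (d + 1) = 2 ^ N := by rw [← pow_add, hN, add_assoc]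
    omega
  refine binf_eq_zero_of_img hxpos hxN ?_
  have h1 := hT.min_le_img (N := N) (by omega) ((lev_lt_iff (by omega) _).2 hxt)
  have h2 := img_add (N := N) (x := 2 ^ t * g + w) (i := t) m
  have h3 := img_le N (2 ^ t * g + w) (t + m)
  -- In these cases `Jumps t` and `img_add` already reach `N = t + d + 1`, as `d < 2 * t`.
  by_cases hcase : d < t ∨ t ≤ m
  · omega
  push Not at hcase
  rcases Nat.eq_zero_or_pos m with hm | hm
  · have h4 : binf (2 ^ t * g + w) (2 ^ t) = 0 := by
      refine binf_two_pow_eq_zero ht hT hG hc.le hQ _ hxlt hxt ?_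
      rw [testBit_eq_false_iff, Nat.mul_add_div (by positivity), Nat.div_eq_of_lt hw, add_zero]
      rw [hm, testBit_eq_false_iff] at hbit
      simpa using hbit
    have h5 : N ≤ img N (2 ^ t * g + w) t :=
      (le_img_iff le_rfl _ _).2 (by rw [h4]; exact dvd_zero _)
    omega
  -- Dropping the top bit gives a row `g % 2 ^ d + 1 < c` to which `Scales` applies. This yields
  -- level `t + d` at `2 ^ t`; since `m ≥ 1`, the missing unit comes from `img_add`.
  · have hbit' : (g % 2 ^ d).testBit m = false := by
      rw [Nat.testBit_mod_two_pow, hbit]; simp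
    have hlt : g % 2 ^ d < 2 ^ d := Nat.mod_lt _ (by positivity)
    have hlt' : g % 2 ^ d + 1 < 2 ^ d := by
      refine lt_of_le_of_ne hlt fun he => not_dvd_succ_of_testBit hbit' ?_
      rw [he]
      exact pow_dvd_pow 2 hmd
    have h4 := binf_two_pow_mul_add_eq_zero hT (by omega) (hQ _ (by omega)) hcase.2 hbit' h0 hw
    have hmod : 2 ^ t * g + w ≡ 2 ^ t * (g % 2 ^ d) + w [MOD 2 ^ (t + d)] := by
      rw [pow_add]
      exact ((Nat.mod_modEq g (2 ^ d)).symm.mul_left' (2 ^ t)).add_right w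
    have h5 : t + d ≤ img N (2 ^ t * g + w) t := by
      refine (le_img_iff (by omega) _ _).2 ?_
      rw [dvd_binf_congr hmod, h4]
      exact dvd_zero _
    omega

theorem scales_of_jumps {t : ℕ} (ht : 0 < t) (hT : Jumps t) (hG : Reaches t) (c : ℕ) :
    c < 2 ^ (2 * t) → Scales t c := by
  induction c using Nat.strong_induction_on with
  | _ c ih =>
  intro hc
  have hQ : ∀ f < c, Scales t f := fun f hf => ih f hf (hf.trans hc)
  have hpos : 0 < 2 ^ t := by positivity
  rcases Nat.eq_zero_or_pos c with rfl | hc0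
  · intro u w _; simp [binf_zero]
  have hcpos : 0 < 2 ^ t * c := by positivity
  suffices h : ∀ y, ∀ u w, w < 2 ^ t → y = 2 ^ t * u + w →
      binf (2 ^ t * c) y = 2 ^ t * binf c u + w from fun u w hw => h _ u w hw rfl
  apply row_induction
  · intro n
    obtain ⟨M, hM⟩ := exists_two_pow_gt (2 ^ t * c + c + n)
    have hM2 : 2 ^ M ≤ 2 ^ (t + M) := Nat.pow_le_pow_right (by norm_num) (by omega)
    refine ⟨2 ^ (t + M) - 1, by omega, fun u w hw hy => ?_⟩
    have e : 2 ^ (t + M) - 1 = 2 ^ t * (2 ^ M - 1) + (2 ^ t - 1) := by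
      have : 2 ^ t * (2 ^ M - 1) + 2 ^ t = 2 ^ (t + M) := by
        rw [pow_add, ← Nat.mul_succ, Nat.succ_eq_add_one, Nat.sub_add_cancel (by omega)]
      omega
    have hu : u = 2 ^ M - 1 := by
      have h1 : (2 ^ t * u + w) / 2 ^ t = u := by
        rw [Nat.mul_add_div hpos, Nat.div_eq_of_lt hw, add_zero]
      rw [← hy, e, Nat.mul_add_div hpos, Nat.div_eq_of_lt (by omega), add_zero] at h1
      exact h1.symm
    have hw' : w = 2 ^ t - 1 := by rw [hu] at hy; omega
    rw [binf_last hcpos (by omega), hu, hw', binf_last hc0 (by omega)]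
    have : 2 ^ t * (c - 1) + 2 ^ t = 2 ^ t * c := by
      rw [← Nat.mul_succ, Nat.succ_eq_add_one, Nat.sub_add_cancel hc0]
    omega
  · intro y hy u w hw hyu
    have hlast : 2 ^ t * c - 1 = 2 ^ t * (c - 1) + (2 ^ t - 1) := by
      have : 2 ^ t * (c - 1) + 2 ^ t = 2 ^ t * c := by
        rw [← Nat.mul_succ, Nat.succ_eq_add_one, Nat.sub_add_cancel hc0]
      omega
    rw [binf_succ hcpos y]
    by_cases hw1 : w + 1 < 2 ^ t
    · rw [hy u (w + 1) hw1 (by omega)]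
      have h1 := binf_two_pow_mul_last (u := u) ht hT hG hc0 hc hQ (Nat.succ_pos w) hw1
      have h2 := binf_succ (x := 2 ^ t * binf c u + (w + 1)) (by omega) (2 ^ t * c - 1)
      rw [Nat.sub_add_cancel hcpos, h1, binf_zero] at h2
      rw [h2]
      omega
    -- At a block boundary the next entry is `2 ^ t * f` with `f < c`, so the induction hypothesis
    -- for `f` evaluates it at the last column of block `c - 1`.
    · have hw2 : w = 2 ^ t - 1 := by omega
      have hy' := hy (u + 1) 0 hpos (by rw [mul_add, mul_one]; omega)
      have hf := binf_lt hc0 (u + 1)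
      rw [hy', hlast, add_zero, hQ _ hf _ _ (by omega), hw2, ← binf_succ hc0 u]

theorem shifts_of_jumps {t : ℕ} (ht : 0 < t) (hT : Jumps t) (hG : Reaches t) :
    Shifts t (2 * t) := by
  intro y hy
  have hpos : 0 < 2 ^ (2 * t) := by positivity
  rw [binf_two_pow_mul_succ (fun f hf => scales_of_jumps ht hT hG f (by omega)) y,
    Nat.sub_add_cancel hpos]
  congr 1
  have h1 : binf (2 ^ (2 * t)) y ≡ y [MOD 2 ^ (2 * t)] := by
    have := binf_modEq (n := 2 * t) (x := 2 ^ (2 * t)) (x' := 0) (by simp [Nat.ModEq])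
      (Nat.ModEq.refl y)
    rwa [binf_zero] at this
  exact Nat.ModEq.eq_of_lt_of_lt h1 (binf_lt hpos y) hy

theorem jumps_and_reaches (k : ℕ) : Jumps (2 ^ k) ∧ Reaches (2 ^ k) := by
  induction k with
  | zero => exact ⟨jumps_one, reaches_one⟩
  | succ k ih =>
    have ht : 0 < 2 ^ k := by positivity
    have hE := shifts_of_jumps ht ih.1 ih.2
    have hG := ih.2.double ht hE
    rw [pow_succ, mul_comm]
    exact ⟨ih.1.double ht hG hE, hG⟩

theorem shifts_two_pow (k : ℕ) : Shifts (2 ^ k) (2 * 2 ^ k) :=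
  shifts_of_jumps (by positivity) (jumps_and_reaches k).1 (jumps_and_reaches k).2

/-! ### Rows which enumerate the multiples of a power of two -/

theorem shifts_zero (d : ℕ) : Shifts 0 d := by
  intro y hy
  have hpos : 0 < 2 ^ d := by positivity
  rw [pow_zero, one_mul, one_mul, Nat.sub_add_cancel hpos]
  have h1 : binf (2 ^ d) y ≡ y [MOD 2 ^ d] := by
    have := binf_modEq (n := d) (x := 2 ^ d) (x' := 0) (by simp [Nat.ModEq]) (Nat.ModEq.refl y)
    rwa [binf_zero] at this
  exact Nat.ModEq.eq_of_lt_of_lt h1 (binf_lt hpos y) hy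

theorem Shifts.comp {s t d D : ℕ} (hs : Shifts s D) (ht : Shifts t d) (h : t + d ≤ D) :
    Shifts (s + t) d := by
  intro y hy
  have hlt : ∀ z < 2 ^ d, 2 ^ t * z < 2 ^ D := fun z hz =>
    lt_of_lt_of_le (Nat.mul_lt_mul_of_pos_left hz (by positivity))
      (by rw [← pow_add]; exact Nat.pow_le_pow_right (by norm_num) h)
  have hpos : 0 < 2 ^ d := by positivity
  have h1 := binf_comp (2 ^ s * (2 ^ D - 1) + 1) (y := 2 ^ t * (2 ^ d - 1) + 1)
    (Nat.succ_pos _) y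
  rw [Nat.add_sub_cancel, hs _ (hlt _ (by omega)), ht y hy, hs _ (hlt y hy), ← mul_assoc,
    ← mul_assoc, ← pow_add] at h1
  exact h1

/-- The two row indices agree modulo `2 ^ (s + d)`, and all entries compared are below that modulus.
-/
theorem Shifts.mono {s d D : ℕ} (hs : Shifts s D) (h : d ≤ D) : Shifts s d := by
  intro y hy
  have hdD : 2 ^ d ≤ 2 ^ D := Nat.pow_le_pow_right (by norm_num) h
  have hd0 : 0 < 2 ^ d := by positivity
  have hmod : 2 ^ s * (2 ^ d - 1) + 1 ≡ 2 ^ s * (2 ^ D - 1) + 1 [MOD 2 ^ (s + d)] := by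
    rw [pow_add]
    refine (Nat.ModEq.mul_left' _ ?_).add_right 1
    refine (Nat.modEq_iff_dvd' (by omega)).2 ?_
    rw [show 2 ^ D - 1 - (2 ^ d - 1) = 2 ^ D - 2 ^ d by omega]
    exact Nat.dvd_sub (pow_dvd_pow 2 h) dvd_rfl
  have h1 := binf_modEq hmod (Nat.ModEq.refl y)
  rw [hs y (hy.trans_le hdD)] at h1
  have hle : 2 ^ s * (2 ^ d - 1) + 2 ^ s = 2 ^ (s + d) := by
    rw [pow_add, ← Nat.mul_succ, Nat.succ_eq_add_one, Nat.sub_add_cancel hd0]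
  have hs0 : 0 < 2 ^ s := by positivity
  refine Nat.ModEq.eq_of_lt_of_lt h1 ?_ ?_
  · have := binf_lt (x := 2 ^ s * (2 ^ d - 1) + 1) (Nat.succ_pos _) y
    omega
  · rw [pow_add]
    exact Nat.mul_lt_mul_of_pos_left hy hs0

theorem shifts_of_dvd (s : ℕ) : ∀ k d, 2 ^ k ∣ 2 * s → d ≤ 2 ^ k → Shifts s d := by
  induction s using Nat.strong_induction_on with
  | _ s ih =>
  intro k d hk hd
  rcases Nat.eq_zero_or_pos s with rfl | hs
  · exact shifts_zero d
  obtain ⟨j, c, ⟨q, rfl⟩, hj⟩ := Nat.exists_eq_two_pow_mul_odd hs.ne'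
  have hkj : k ≤ j + 1 := by
    have h1 : 2 ^ k ∣ 2 ^ (j + 1) * (2 * q + 1) := by
      rwa [pow_succ', mul_assoc, ← hj]
    have h2 : Nat.Coprime (2 ^ k) (2 * q + 1) :=
      Nat.Coprime.pow_left k ((Nat.Prime.coprime_iff_not_dvd Nat.prime_two).2 (by omega))
    exact (Nat.pow_dvd_pow_iff_le_right (by norm_num)).1 (h2.dvd_of_dvd_mul_right h1)
  have hpos : 0 < 2 ^ j := by positivity
  have hsum : s = 2 ^ j * (2 * q) + 2 ^ j := by rw [hj]; ring
  have h4 : 2 ^ (j + 2) = 4 * 2 ^ j := by ring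
  -- Removing the lowest binary digit `2 ^ j` of `s` leaves a multiple of `2 ^ (j + 1)`, so the
  -- width `4 * 2 ^ j` is available and accommodates `2 ^ j + 2 * 2 ^ j`.
  have hrest : Shifts (2 ^ j * (2 * q)) (4 * 2 ^ j) :=
    ih _ (by omega) (j + 2) _ ⟨q, by ring⟩ h4.ge
  have h := hrest.comp (shifts_two_pow j) (by omega)
  rw [← hsum] at h
  refine h.mono (hd.trans ?_)
  rw [← pow_succ']
  exact Nat.pow_le_pow_right (by norm_num) hkj

/-! ### Period lengths -/

theorem oneBits_eq (x : ℕ) : oneBits x = oneBits (x / 2) + x % 2 := by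
  rcases Nat.eq_zero_or_pos x with rfl | hx
  · simp [oneBits]
  · unfold oneBits
    rw [Nat.digits_def' (by norm_num) hx, List.count_cons]
    rcases Nat.mod_two_eq_zero_or_one x with h | h <;> simp [h]

theorem oneBits_two_pow_mul (s x : ℕ) : oneBits (2 ^ s * x) = oneBits x := by
  induction s with
  | zero => simp
  | succ s ih =>
    rw [oneBits_eq, pow_succ', mul_assoc, Nat.mul_div_cancel_left _ (by norm_num), ih]
    simp

theorem oneBits_two_pow_sub_one (d : ℕ) : oneBits (2 ^ d - 1) = d := by
  induction d with
  | zero => simp [oneBits]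
  | succ d ih =>
    have hpos : 0 < 2 ^ d := by positivity
    have h2 : 2 ^ (d + 1) = 2 * 2 ^ d := by ring
    rw [oneBits_eq, show (2 ^ (d + 1) - 1) / 2 = 2 ^ d - 1 by omega, ih]
    omega

/-- Induction by halving: a fibre of `z ↦ z / 2` on `S` has at most one element if `x` is even and
at most two if `x` is odd. -/
theorem card_le_of_testBit (x : ℕ) : ∀ S : Finset ℕ,
    (∀ z ∈ S, ∀ i, z.testBit i = true → x.testBit i = true) → S.card ≤ 2 ^ oneBits x := by
  induction x using Nat.strong_induction_on with
  | _ x ih =>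
  intro S hS
  rcases Nat.eq_zero_or_pos x with rfl | hx
  · have : S ⊆ {0} := fun z hz => by
      rw [Finset.mem_singleton]
      exact Nat.eq_of_testBit_eq fun i => by
        rw [Nat.zero_testBit]
        by_contra hc
        have := hS z hz i (by simpa using hc)
        simp at this
    simpa [oneBits] using Finset.card_le_card this
  have himage : (S.image (· / 2)).card ≤ 2 ^ oneBits (x / 2) := by
    refine ih _ (Nat.div_lt_self hx (by norm_num)) _ fun z hz i hi => ?_
    obtain ⟨y, hy, rfl⟩ := Finset.mem_image.1 hz
    rw [← Nat.testBit_add_one] at hi ⊢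
    exact hS y hy _ hi
  have hfib : S.card ≤ 2 ^ (x % 2) * (S.image (· / 2)).card := by
    refine Finset.card_le_mul_card_image S _ fun a _ => ?_
    rcases Nat.mod_two_eq_zero_or_one x with h | h
    · have : S.filter (fun z => z / 2 = a) ⊆ {2 * a} := fun z hz => by
        obtain ⟨hz1, hz2⟩ := Finset.mem_filter.1 hz
        rw [Finset.mem_singleton]
        have : z % 2 = 0 := by
          by_contra hc
          have := hS z hz1 0 (by rw [Nat.testBit_zero]; simpa using hc)
          rw [Nat.testBit_zero, h] at this
          simp at this
        omega
      rw [h]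
      simpa using Finset.card_le_card this
    · have : S.filter (fun z => z / 2 = a) ⊆ {2 * a, 2 * a + 1} := fun z hz => by
        obtain ⟨_, hz2⟩ := Finset.mem_filter.1 hz
        rw [Finset.mem_insert, Finset.mem_singleton]
        omega
      rw [h]
      exact (Finset.card_le_card this).trans Finset.card_le_two
  calc S.card ≤ 2 ^ (x % 2) * (S.image (· / 2)).card := hfib
    _ ≤ 2 ^ (x % 2) * 2 ^ oneBits (x / 2) := Nat.mul_le_mul_left _ himage
    _ = 2 ^ oneBits x := by rw [← pow_add, oneBits_eq x, add_comm]

/-- The period length of `x + 1` is a power of two, at most two to the number of one bits of `x`,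
and the entries within one period are distinct. -/
theorem exists_hasPeriodLength (x : ℕ) : ∃ o ≤ oneBits x, HasPeriodLength (x + 1) (2 ^ o) ∧
    ∀ y, binf (x + 1) y = 0 ↔ 2 ^ o ∣ y := by
  obtain ⟨o, ho⟩ := exists_row_period (Nat.succ_pos x)
  have hzero : ∀ y, binf (x + 1) y = 0 ↔ 2 ^ o ∣ y := fun y => by
    rw [← Nat.modEq_zero_iff_dvd, ← ho, Nat.succ_eq_add_one, binf_right_zero]
  refine ⟨o, ?_, ⟨⟨by positivity, fun i => (ho _ _).2 (by simp [Nat.ModEq])⟩, ?_⟩, hzero⟩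
  · have h1 := card_le_of_testBit x ((Finset.range (2 ^ o)).image (binf (x + 1)))
      fun z hz i hi => by
        obtain ⟨y, _, rfl⟩ := Finset.mem_image.1 hz
        exact testBit_binf_succ hi
    rw [Finset.card_image_of_injOn, Finset.card_range] at h1
    · exact (Nat.pow_le_pow_iff_right (by norm_num)).1 h1
    · intro y hy y' hy' h
      exact Nat.ModEq.eq_of_lt_of_lt ((ho _ _).1 h) (by simpa using hy) (by simpa using hy')
  · rintro q ⟨hq, hper⟩
    have := hper 0
    rw [zero_add, binf_right_zero, hzero] at this
    exact Nat.le_of_dvd hq this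

theorem Shifts.hasPeriodLength {s d : ℕ} (h : Shifts s d) :
    HasPeriodLength (2 ^ s * (2 ^ d - 1) + 1) (2 ^ d) := by
  obtain ⟨o, ho, hper, hzero⟩ := exists_hasPeriodLength (2 ^ s * (2 ^ d - 1))
  rw [oneBits_two_pow_mul, oneBits_two_pow_sub_one] at ho
  rcases ho.lt_or_eq with hlt | rfl
  · have h1 := h _ (Nat.pow_lt_pow_right (a := 2) (by norm_num) hlt)
    rw [(hzero _).2 dvd_rfl] at h1
    have : 0 < 2 ^ s * 2 ^ o := by positivity
    omega
  · exact hper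

end Laver

theorem lemma4p3 (s s' : ℕ) (hs : s ≤ s') (h : ∃ k : ℕ, 2 ^ k ∣ 2 * s ∧ s' - s ≤ 2 ^ k) :
    Laver.HasPeriodLength (2 ^ s' - 2 ^ s + 1) (2 ^ (s' - s)) ∧
      Laver.oneBits (2 ^ s' - 2 ^ s) = s' - s ∧
      ∀ x : ℕ, Laver.oneBits x = s' - s →
        ∃ p : ℕ, Laver.HasPeriodLength (x + 1) p ∧ p ≤ 2 ^ (s' - s) := by
  obtain ⟨k, hk, hd⟩ := h
  have e : 2 ^ s' - 2 ^ s = 2 ^ s * (2 ^ (s' - s) - 1) := by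
    rw [Nat.mul_sub, mul_one, ← pow_add, Nat.add_sub_cancel' hs]
  rw [e]
  refine ⟨(Laver.shifts_of_dvd s k _ hk hd).hasPeriodLength, ?_, fun x hx => ?_⟩
  · rw [Laver.oneBits_two_pow_mul, Laver.oneBits_two_pow_sub_one]
  · obtain ⟨o, ho, hper, _⟩ := Laver.exists_hasPeriodLength x
    exact ⟨2 ^ o, hper, Nat.pow_le_pow_right (by norm_num) (hx ▸ ho)⟩
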